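/- Let $d\ge 0$ and $m\ge 1$ be integers, $N=2^m-1$, $\lambda>0$, and let $\rho=1+\sqrt2$ be the silver ratio. The silver schedule $\pi^{(m)}=(\pi^{(m)}_0,\dots,\pi^{(m)}_{N-1})$ is defined by $\pi^{(1)}=[\sqrt2]$ and $\pi^{(k+1)}=[\pi^{(k)},\,1+\rho^{k-1},\,\pi^{(k)}]$ for $k\ge1$. For a proper, closed, convex function $f:\mathbb{R}^d\to\mathbb{R}\cup\{\infty\}$ that has a minimizer, let $$\mathrm{Prox}_{\lambda f}(x)=\arg\min_{u}\Big\{f(u)+\tfrac1{2\lambda}\|u-x\|^2\Big\},\qquad f^\lambda(x)=\min_u\Big\{f(u)+\tfrac1{2\lambda}\|u-x\|^2\Big\}.$$ The relaxed proximal point algorithm (RPPA) with schedule $\pi^{(m)}$ and starting point $x^0\in\mathbb{R}^d$ is $$z^k=\mathrm{Prox}_{\lambda f}(x^k)\ (0\le k\le N),\qquad x^{k+1}=x^k+\pi^{(m)}_k(z^k-x^k)\ (0\le k<N).$$ **Theorem.** (a) For every such $f$, every minimizer $x^\star$ of $f$ and every $x^0\in\mathbb{R}^d$: the minimum defining $f^\lambda(x)$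 is finite and attained at exactly one point for every $x$, $f^\lambda$ is differentiable on $\mathbb{R}^d$, and $$f(z^N)+\frac{\lambda}{2}\|\nabla f^\lambda(x^N)\|^2-f(x^\star)\le\frac{\|x^0-x^\star\|^2}{(4\rho^m-2)\lambda},\qquad \|\nabla f^\lambda(x^N)\|\le\frac{\|x^0-x^\star\|}{\rho^m\lambda}.$$ (b) The second bound is tight: for all $x^0,x^\star\in\mathbb{R}^d$ there is a proper, closed, convex $f$ with minimizer $x^\star$ such that RPPA started at $x^0$ satisfies $\|\nabla f^\lambda(x^N)\|=\|x^0-x^\star\|/(\rho^m\lambda)$. (c) $\rho^m=(N+1)^{\log_2\rho}$, where $\log_2\rho\approx1.2716$ (that is, $|\log_2\rho-1.2716|<5\cdot10^{-5}$), and consequently, in the situation of (a), there is an $O(1/N^{\log_2\rho})$ rate: $$f(z^N)+\frac{\lambda}{2}\|\nabla f^\lambda(x^N)\|^2-f(x^\star)\le\frac{\|x^0-x^\star\|^2}{2\lambda N^{\log_2\rho}},\qquad \|\nabla f^\lambda(x^N)\|\le\frac{\|x^0-x^\star\|}{\lambda N^{\log_2\rho}}.$$ -/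

import Mathlib

noncomputable section

/-- `ℝ^d` with the Euclidean norm. -/
abbrev Euc (d : ℕ) : Type := EuclideanSpace ℝ (Fin d)

/-- Proper, closed (lower semicontinuous) and convex extended-real-valued functions.
Convexity is convexity of the epigraph. -/
structure ProperClosedConvex {d : ℕ} (f : Euc d → EReal) : Prop where
  ne_bot : ∀ x, f x ≠ ⊥
  exists_ne_top : ∃ x, f x ≠ ⊤
  lsc : LowerSemicontinuous f
  convex_epigraph : Convex ℝ {p : Euc d × ℝ | f p.1 ≤ (p.2 : EReal)}

/-- The set of global minimizers of `f`. -/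
def minimizers {d : ℕ} (f : Euc d → EReal) : Set (Euc d) :=
  {x | ∀ y, f x ≤ f y}

/-- The function `u ↦ f u + (1 / (2 lam)) * ‖u - x‖ ^ 2`. -/
def proxObjective {d : ℕ} (f : Euc d → EReal) (lam : ℝ) (x u : Euc d) : EReal :=
  f u + ((1 / (2 * lam) * ‖u - x‖ ^ 2 : ℝ) : EReal)

/-- The proximal mapping: a minimizer of the proximal objective (an arbitrary point if there
is none). -/
def prox {d : ℕ} (f : Euc d → EReal) (lam : ℝ) (x : Euc d) : Euc d :=
  Classical.epsilon fun z => z ∈ minimizers (proxObjective f lam x)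

/-- The Moreau envelope, as a real-valued function. -/
def moreauEnvelope {d : ℕ} (f : Euc d → EReal) (lam : ℝ) (x : Euc d) : ℝ :=
  (⨅ u, proxObjective f lam x u).toReal

/-- The iterates `x^k` of the relaxed proximal point algorithm with relaxation parameters
`α k`. -/
def rppaX {d : ℕ} (f : Euc d → EReal) (lam : ℝ) (α : ℕ → ℝ) (x0 : Euc d) : ℕ → Euc d
  | 0 => x0
  | k + 1 => rppaX f lam α x0 k +
      α k • (prox f lam (rppaX f lam α x0 k) - rppaX f lam α x0 k)

/-- The proximal points `z^k` of the relaxed proximal point algorithm. -/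
def rppaZ {d : ℕ} (f : Euc d → EReal) (lam : ℝ) (α : ℕ → ℝ) (x0 : Euc d) (k : ℕ) : Euc d :=
  prox f lam (rppaX f lam α x0 k)

/-- The silver ratio. -/
def silverRatio : ℝ := 1 + √2

/-- The silver schedule `π^(m)` for `m ≥ 1`, as a list (empty for `m = 0`). -/
def silverList : ℕ → List ℝ
  | 0 => []
  | 1 => [√2]
  | m + 2 => silverList (m + 1) ++ [1 + silverRatio ^ m] ++ silverList (m + 1)

theorem length_silverList (m : ℕ) : (silverList m).length = 2 ^ m - 1 := by
  induction m using silverList.induct with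
  | case1 => simp [silverList]
  | case2 => simp [silverList]
  | case3 m ih =>
    have h : 1 ≤ 2 ^ m := Nat.one_le_two_pow
    simp only [silverList, List.length_append, ih, List.length_singleton, pow_succ]
    omega

/-- The entries of the silver schedule; only the indices `i < 2 ^ m - 1` matter. -/
def silverSchedule (m i : ℕ) : ℝ := (silverList m).getD i 0

end

/-!
Put `h = λ f` and `P = Prox_{λ f}`. All that the upper bounds use of `P` is the subgradient
inequality `h (P x) + ⟪x - P x, P y - P x⟫ ≤ h (P y)`. Say that a map `T` has rate `r` if
`r h(P p) + r² / 2 ‖p - P p‖² + 1 / 2 ‖P p - P y‖² ≤ 1 / 2 ‖x - P y‖² + r h(P y)` for all `x`, `y`,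
where `p = T x`. The identity has rate `1`. If `T` has rate `r`, then running `T`, one relaxed step
of length `1 + r / ρ` and `T` again has rate `ρ r`: add the rate inequalities of both runs at `y`,
and absorb the error terms by those of the second run at its starting node and at its own endpoint.
Hence the silver schedule has rate `ρ ^ m`, and `y = x⋆` gives both upper bounds.

The gradient bound is attained by a multiple of `‖· - x⋆‖`: on the ray from `x⋆` through `x⁰`,
the proximal step is a translation by `x⋆ - x⁰` scaled by `ρ ^ (-m)`, and since the relaxation
parameters sum to `ρ ^ m - 1`, the algorithm reaches the point where this ceases to hold only at
its last iterate.
-/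

/-! ### The silver schedule -/

theorem silverRatio_sq : silverRatio ^ 2 = 2 * silverRatio + 1 := by
  have hsqrt : √2 ^ 2 = 2 := Real.sq_sqrt (by norm_num)
  unfold silverRatio
  linear_combination hsqrt

theorem one_le_silverRatio : 1 ≤ silverRatio := by
  simp [silverRatio]

theorem silverRatio_pos : 0 < silverRatio :=
  one_pos.trans_le one_le_silverRatio

theorem one_add_inv_silverRatio : 1 + silverRatio⁻¹ = √2 := by
  have hsqrt : √2 = silverRatio - 1 := by simp [silverRatio]
  have hpos := silverRatio_pos
  rw [hsqrt]
  field_simp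
  linear_combination -silverRatio_sq

theorem silverList_succ (m : ℕ) :
    silverList (m + 1)
      = silverList m ++ [1 + silverRatio ^ m / silverRatio] ++ silverList m := by
  cases m with
  | zero => simp [silverList, one_add_inv_silverRatio]
  | succ m => rw [silverList, pow_succ, mul_div_cancel_right₀ _ silverRatio_pos.ne']

theorem nonneg_of_mem_silverList {m : ℕ} {a : ℝ} (ha : a ∈ silverList m) : 0 ≤ a := by
  have hpos := silverRatio_pos
  induction m with
  | zero => simp [silverList] at ha
  | succ m ih =>
    simp only [silverList_succ, List.mem_append, List.mem_singleton] at ha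
    rcases ha with (ha | rfl) | ha
    · exact ih ha
    · positivity
    · exact ih ha

theorem sum_silverList (m : ℕ) : (silverList m).sum = silverRatio ^ m - 1 := by
  induction m with
  | zero => simp [silverList]
  | succ m ih =>
    have hpos := silverRatio_pos
    simp only [silverList_succ, List.sum_append, List.sum_singleton, ih]
    field_simp
    linear_combination -silverRatio ^ m * silverRatio_sq

theorem pow_rpow_logb {b x : ℝ} (hb : 0 < b) (hb1 : b ≠ 1) (hx : 0 < x) (m : ℕ) :
    (b ^ m) ^ Real.logb b x = x ^ m := by
  rw [← Real.rpow_pow_comm hb.le, Real.rpow_logb hb hb1 hx]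

theorem silverRatio_pow_eq (m : ℕ) :
    silverRatio ^ m = (((2 ^ m - 1 : ℕ) : ℝ) + 1) ^ Real.logb 2 silverRatio := by
  have hN : ((2 ^ m - 1 : ℕ) : ℝ) + 1 = 2 ^ m := by
    exact_mod_cast Nat.sub_add_cancel Nat.one_le_two_pow
  rw [hN, pow_rpow_logb two_pos (by norm_num) silverRatio_pos]

theorem rpow_logb_le_silverRatio_pow (m : ℕ) :
    ((2 ^ m - 1 : ℕ) : ℝ) ^ Real.logb 2 silverRatio ≤ silverRatio ^ m := by
  rw [silverRatio_pow_eq]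
  exact Real.rpow_le_rpow (Nat.cast_nonneg _) (by linarith)
    (Real.logb_nonneg one_lt_two one_le_silverRatio)

theorem div_lt_logb_of_pow_lt {b x : ℝ} (hb : 1 < b) (hx : 0 < x) {p q : ℕ} (hq : 0 < q)
    (h : b ^ p < x ^ q) : (p : ℝ) / q < Real.logb b x := by
  rw [div_lt_iff₀' (by positivity), ← Real.logb_pow, Real.lt_logb_iff_rpow_lt hb (by positivity),
    Real.rpow_natCast]
  exact h

theorem logb_lt_div_of_pow_lt {b x : ℝ} (hb : 1 < b) (hx : 0 < x) {p q : ℕ} (hq : 0 < q)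
    (h : x ^ q < b ^ p) : Real.logb b x < (p : ℝ) / q := by
  rw [lt_div_iff₀' (by positivity), ← Real.logb_pow, Real.logb_lt_iff_lt_rpow hb (by positivity),
    Real.rpow_natCast]
  exact h

set_option exponentiation.threshold 300 in
theorem abs_logb_silverRatio_sub_lt : |Real.logb 2 silverRatio - 1.2716| < 0.00005 := by
  have hlo : (2.4142135 : ℝ) ≤ silverRatio := by
    have : (1.4142135 : ℝ) ≤ √2 := Real.le_sqrt_of_sq_le (by norm_num)
    unfold silverRatio
    linarith
  have hhi : silverRatio ≤ 2.41422 := by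
    have : √2 ≤ (1.41422 : ℝ) := Real.sqrt_le_iff.2 (by norm_num)
    unfold silverRatio
    linarith
  -- `295 / 232` and `103 / 81` are consecutive continued fraction convergents of the logarithm.
  have hlower := div_lt_logb_of_pow_lt (p := 295) (q := 232) one_lt_two silverRatio_pos
    (by norm_num) (lt_of_lt_of_le (by norm_num) (pow_le_pow_left₀ (by norm_num) hlo 232))
  have hupper := logb_lt_div_of_pow_lt (p := 103) (q := 81) one_lt_two silverRatio_pos
    (by norm_num) ((pow_le_pow_left₀ silverRatio_pos.le hhi 81).trans_lt (by norm_num))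
  rw [abs_lt]
  constructor <;> norm_num at hlower hupper ⊢ <;> linarith

/-! ### Relaxed proximal steps and their rates -/

section Rates

open scoped RealInnerProductSpace Topology

/-- One step of length `a` from `x` towards (and, for `a > 1`, past) `P x`. A schedule is run from
`x` by `List.foldl (relaxedStep P) x`. -/
def relaxedStep {E : Type*} [AddCommGroup E] [Module ℝ E] (P : E → E) (x : E) (a : ℝ) : E :=
  x + a • (P x - x)

theorem foldl_relaxedStep_ray {E : Type*} [AddCommGroup E] [Module ℝ E] {P : E → E}
    {xs w : E} {η : ℝ} (hη : 0 ≤ η)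
    (hP : ∀ τ, η ≤ τ → P (xs + τ • w) = xs + (τ - η) • w) (l : List ℝ) (hl : ∀ a ∈ l, 0 ≤ a)
    (τ : ℝ) (hτ : η * (1 + l.sum) ≤ τ) :
    l.foldl (relaxedStep P) (xs + τ • w) = xs + (τ - η * l.sum) • w := by
  induction l generalizing τ with
  | nil => simp
  | cons a l ih =>
    have hl' : ∀ b ∈ l, 0 ≤ b := fun b hb => hl b (List.mem_cons_of_mem _ hb)
    have ha : 0 ≤ η * a := mul_nonneg hη (hl a List.mem_cons_self)
    have hsum : 0 ≤ η * l.sum := mul_nonneg hη (List.sum_nonneg hl')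
    rw [List.sum_cons] at hτ ⊢
    have hstep : relaxedStep P (xs + τ • w) a = xs + (τ - η * a) • w := by
      rw [relaxedStep, hP τ (by linarith)]
      module
    rw [List.foldl_cons, hstep, ih hl' _ (by linarith)]
    module

variable {E : Type*} [NormedAddCommGroup E]

/-- The rate certificate of a map `T`, typically a run of relaxed proximal steps: for a minimizer
`y = P y` of `h` it bounds the value of `h` at `P (T x)` and the residual `T x - P (T x)`. Comparing
with all points `P y` instead makes it stable under composition. -/
def ProxRate (h : E → ℝ) (P T : E → E) (r : ℝ) : Prop :=
  ∀ x y, r * h (P (T x)) + r ^ 2 / 2 * ‖T x - P (T x)‖ ^ 2 + 1 / 2 * ‖P (T x) - P y‖ ^ 2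
    ≤ 1 / 2 * ‖x - P y‖ ^ 2 + r * h (P y)

variable {h : E → ℝ} {P T : E → E} {r : ℝ}

theorem ProxRate.norm_residual_sq_le (hT : ProxRate h P T r) (x : E) :
    r ^ 2 * ‖T x - P (T x)‖ ^ 2 ≤ ‖x - P (T x)‖ ^ 2 := by
  have hself := hT x (T x)
  rw [sub_self, norm_zero] at hself
  linarith

variable [InnerProductSpace ℝ E]

/-- `P` satisfies the subgradient inequality of the proximal map of `h`, namely
`x - P x ∈ ∂h (P x)`, tested on the range of `P` only, so that the values of `h` elsewhere do not
matter. -/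
def ProxInequality (h : E → ℝ) (P : E → E) : Prop :=
  ∀ x y, h (P x) + ⟪x - P x, P y - P x⟫ ≤ h (P y)

theorem norm_relaxedStep_one_add_sub_sq (P : E → E) (x z : E) (t : ℝ) :
    ‖relaxedStep P x (1 + t) - z‖ ^ 2
      = ‖P x - z‖ ^ 2 + 2 * t * ⟪x - P x, z - P x⟫ + t ^ 2 * ‖x - P x‖ ^ 2 := by
  have hsplit : relaxedStep P x (1 + t) - z = (P x - z) - t • (x - P x) := by
    unfold relaxedStep
    module
  rw [hsplit, norm_sub_sq_real, norm_smul, Real.norm_eq_abs, mul_pow, sq_abs, inner_smul_right,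
    real_inner_comm, ← neg_sub z (P x), inner_neg_right, norm_neg]
  ring

theorem ProxInequality.proxRate_id (hP : ProxInequality h P) : ProxRate h P id 1 := by
  intro x y
  have hsubgrad := hP x y
  have hsplit : x - P y = (x - P x) - (P y - P x) := by abel
  rw [id_eq, hsplit, norm_sub_sq_real (x - P x), norm_sub_rev (P x) (P y)]
  linarith

/-- This pays for the error terms that remain when the rate inequalities of two runs of `T`,
joined by a step of length `1 + t` from `n`, are added. -/
theorem ProxRate.long_step_le {t : ℝ} (hT : ProxRate h P T (silverRatio * t))
    (hP : ProxInequality h P) (ht : 0 ≤ t) (n : E) {p : E}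
    (hp : p = T (relaxedStep P n (1 + t))) :
    (silverRatio + 1) * t * (h (P p) - h (P n))
      + silverRatio * (silverRatio * t) ^ 2 * ‖p - P p‖ ^ 2
    ≤ silverRatio * t ^ 2 * ‖n - P n‖ ^ 2 := by
  have hnode := hT (relaxedStep P n (1 + t)) n
  have hend := hT.norm_residual_sq_le (relaxedStep P n (1 + t))
  rw [← hp, norm_relaxedStep_one_add_sub_sq] at hnode hend
  rw [sub_self, norm_zero, inner_zero_right] at hnode
  rw [norm_sub_rev (P n)] at hend
  have hruns := mul_le_mul_of_nonneg_left
    (add_le_add hnode (div_le_div_of_nonneg_right hend zero_le_two)) silverRatio_pos.le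
  have hsubgrad := mul_le_mul_of_nonneg_left (hP n p) (mul_nonneg silverRatio_pos.le ht)
  linear_combination hruns + hsubgrad - t * (h (P p) - h (P n)) * silverRatio_sq

theorem ProxRate.silver_comp (hT : ProxRate h P T r) (hP : ProxInequality h P) (hr : 0 ≤ r) :
    ProxRate h P (fun x => T (relaxedStep P (T x) (1 + r / silverRatio))) (silverRatio * r) := by
  intro x y
  have ht : 0 ≤ r / silverRatio := div_nonneg hr silverRatio_pos.le
  obtain ⟨t, rfl⟩ : ∃ t, r = silverRatio * t :=
    ⟨r / silverRatio, (mul_div_cancel₀ r silverRatio_pos.ne').symm⟩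
  rw [mul_div_cancel_left₀ t silverRatio_pos.ne'] at ht ⊢
  set n := T x
  set p := T (relaxedStep P n (1 + t)) with hp
  have hfirst := hT x y
  have hsecond := hT (relaxedStep P n (1 + t)) y
  have herror := hT.long_step_le hP ht n hp
  have hsubgrad := mul_le_mul_of_nonneg_left (hP n y) ht
  rw [norm_relaxedStep_one_add_sub_sq] at hsecond
  linear_combination hfirst + hsecond + herror + hsubgrad
    + ((silverRatio * t) ^ 2 / 2 * ‖p - P p‖ ^ 2 - t ^ 2 / 2 * ‖n - P n‖ ^ 2
      + t * (h (P p) - h (P y))) * silverRatio_sq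

theorem ProxInequality.proxRate_silverList (hP : ProxInequality h P) (m : ℕ) :
    ProxRate h P ((silverList m).foldl (relaxedStep P)) (silverRatio ^ m) := by
  induction m with
  | zero => exact (pow_zero silverRatio).symm ▸ hP.proxRate_id
  | succ m ih =>
    have hstep := ih.silver_comp hP (pow_nonneg silverRatio_pos.le m)
    simpa only [silverList_succ, List.foldl_append, List.foldl_cons, List.foldl_nil, pow_succ']
      using hstep

theorem ProxRate.mul_norm_residual_le (hT : ProxRate h P T r) (hP : ProxInequality h P)
    (hr : 0 ≤ r) (x : E) {y : E} (hy : P y = y) : r * ‖T x - P (T x)‖ ≤ ‖x - y‖ := by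
  have hrate := hT x y
  have hmin := hP y (T x)
  rw [hy, sub_self, inner_zero_left, add_zero] at hmin
  rw [hy] at hrate
  refine le_of_sq_le_sq ?_ (norm_nonneg _)
  nlinarith [mul_le_mul_of_nonneg_left hmin hr, sq_nonneg ‖P (T x) - y‖]

theorem ProxRate.mul_value_sub_le (hT : ProxRate h P T r) (hP : ProxInequality h P)
    (hr : 1 ≤ r) (x : E) {y : E} (hy : P y = y) :
    (4 * r - 2) * (h (P (T x)) + 1 / 2 * ‖T x - P (T x)‖ ^ 2 - h y) ≤ ‖x - y‖ ^ 2 := by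
  have hrate := hT x y
  have hsubgrad := mul_le_mul_of_nonneg_left (hP (T x) y) (sub_nonneg.2 hr)
  have hsq := sq_nonneg ‖(y - P (T x)) + (r - 1) • (T x - P (T x))‖
  rw [hy] at hrate hsubgrad
  rw [norm_add_sq_real, norm_smul, mul_pow, Real.norm_eq_abs, sq_abs, inner_smul_right,
    real_inner_comm, norm_sub_rev] at hsq
  linear_combination 2 * hrate + 2 * hsubgrad + hsq

theorem ProxInequality.envelope_le (hP : ProxInequality h P) (x y : E) :
    h (P x) + 1 / 2 * ‖x - P x‖ ^ 2 + ⟪x - P x, y - x⟫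
        + 1 / 2 * ‖(x - P x) - (y - P y)‖ ^ 2
      ≤ h (P y) + 1 / 2 * ‖y - P y‖ ^ 2 := by
  have hsubgrad := hP x y
  have hsplit : P y - P x = (y - x) + ((x - P x) - (y - P y)) := by abel
  rw [hsplit, inner_add_right, inner_sub_right _ (x - P x), real_inner_self_eq_norm_sq] at hsubgrad
  rw [norm_sub_sq_real (x - P x)]
  linarith

theorem ProxInequality.envelope_sub_mem_Icc (hP : ProxInequality h P) (x y : E) :
    h (P y) + 1 / 2 * ‖y - P y‖ ^ 2 - (h (P x) + 1 / 2 * ‖x - P x‖ ^ 2) - ⟪x - P x, y - x⟫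
      ∈ Set.Icc 0 (‖y - x‖ ^ 2) := by
  have hxy := hP.envelope_le x y
  have hyx := hP.envelope_le y x
  have hcross := sq_nonneg ‖(y - x) + ((x - P x) - (y - P y))‖
  rw [norm_add_sq_real, inner_sub_right, real_inner_comm, real_inner_comm (y - P y)] at hcross
  rw [← neg_sub y x, inner_neg_right, norm_sub_rev (y - P y)] at hyx
  constructor <;> nlinarith [sq_nonneg ‖y - x‖, sq_nonneg ‖(x - P x) - (y - P y)‖]

theorem ProxInequality.hasGradientAt [CompleteSpace E] (hP : ProxInequality h P) (x : E) :
    HasGradientAt (fun x => h (P x) + 1 / 2 * ‖x - P x‖ ^ 2) (x - P x) x := by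
  rw [hasGradientAt_iff_isLittleO]
  have hquadratic : (fun y => ‖y - x‖ ^ 2) =o[𝓝 x] fun y => y - x := by
    simpa using Asymptotics.isLittleO_pow_sub_sub x one_lt_two
  refine (Asymptotics.isBigO_of_le _ fun y => ?_).trans_isLittleO hquadratic
  obtain ⟨hlower, hupper⟩ := hP.envelope_sub_mem_Icc x y
  rw [norm_pow, norm_norm, Real.norm_of_nonneg hlower]
  exact hupper

end Rates

/-! ### Proximal maps and Moreau envelopes -/

theorem le_of_forall_mem_Ioc_le_add_mul {A B C : ℝ} (h : ∀ s ∈ Set.Ioc (0 : ℝ) 1, A ≤ B + s * C) :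
    A ≤ B := by
  have hlim : Filter.Tendsto (fun s => B + s * C) (nhdsWithin 0 (Set.Ioi 0)) (nhds B) := by
    have hcont : Continuous fun s => B + s * C := by fun_prop
    simpa using (hcont.tendsto 0).mono_left nhdsWithin_le_nhds
  exact ge_of_tendsto hlim (Filter.mem_of_superset (Ioc_mem_nhdsGT one_pos) h)

section Moreau

variable {d : ℕ} {f : Euc d → EReal} {lam : ℝ}

theorem ProperClosedConvex.coe_toReal (hf : ProperClosedConvex f) {x : Euc d}
    (hx : f x ≠ ⊤) : ((f x).toReal : EReal) = f x :=
  EReal.coe_toReal hx (hf.ne_bot x)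

theorem ProperClosedConvex.ne_top_of_mem_minimizers (hf : ProperClosedConvex f) {x : Euc d}
    (hx : x ∈ minimizers f) : f x ≠ ⊤ := by
  obtain ⟨y, hy⟩ := hf.exists_ne_top
  exact ne_top_of_le_ne_top hy (hx y)

theorem ProperClosedConvex.ne_top_of_mem_minimizers_proxObjective (hf : ProperClosedConvex f)
    {x z : Euc d} (hz : z ∈ minimizers (proxObjective f lam x)) : f z ≠ ⊤ := by
  obtain ⟨y, hy⟩ := hf.exists_ne_top
  have hobj : proxObjective f lam x z ≠ ⊤ :=
    ne_top_of_le_ne_top (EReal.add_ne_top hy (EReal.coe_ne_top _)) (hz y)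
  exact fun h => hobj (by rw [proxObjective, h, EReal.top_add_coe])

theorem ProperClosedConvex.lowerSemicontinuous_proxObjective (hf : ProperClosedConvex f)
    (lam : ℝ) (x : Euc d) : LowerSemicontinuous (proxObjective f lam x) := by
  refine hf.lsc.add' (Continuous.lowerSemicontinuous ?_) fun u => ?_
  · exact continuous_coe_real_ereal.comp (by fun_prop)
  · exact EReal.continuousAt_add (Or.inr (EReal.coe_ne_bot _)) (Or.inl (hf.ne_bot u))

theorem ProperClosedConvex.exists_mem_minimizers_proxObjective (hf : ProperClosedConvex f)
    (hlam : 0 < lam) (hmin : (minimizers f).Nonempty) (x : Euc d) :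
    ∃ z, z ∈ minimizers (proxObjective f lam x) := by
  obtain ⟨y, hy⟩ := hmin
  have hball : y ∈ Metric.closedBall x ‖y - x‖ := by simp [dist_eq_norm]
  obtain ⟨z, -, hz⟩ := LowerSemicontinuousOn.exists_isMinOn ⟨y, hball⟩
    (isCompact_closedBall x ‖y - x‖)
    ((hf.lowerSemicontinuous_proxObjective lam x).lowerSemicontinuousOn _)
  refine ⟨z, fun u => ?_⟩
  by_cases hu : u ∈ Metric.closedBall x ‖y - x‖
  · exact hz hu
  · refine (hz hball).trans (add_le_add (hy u) (EReal.coe_le_coe_iff.2 ?_))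
    rw [Metric.mem_closedBall, dist_eq_norm, not_le] at hu
    gcongr

theorem ProperClosedConvex.add_inner_le_of_mem_minimizers (hf : ProperClosedConvex f)
    (hlam : 0 < lam) {x z u : Euc d} (hz : z ∈ minimizers (proxObjective f lam x)) {a b : ℝ}
    (ha : f z = a) (hb : f u = b) : lam * a + inner ℝ (x - z) (u - z) ≤ lam * b := by
  refine le_of_forall_mem_Ioc_le_add_mul (C := 1 / 2 * ‖u - z‖ ^ 2) fun s hs => ?_
  have hconv : f ((1 - s) • z + s • u) ≤ ((1 - s) * a + s * b : ℝ) :=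
    hf.convex_epigraph (x := (z, a)) (y := (u, b)) ha.le hb.le
      (sub_nonneg.2 hs.2) hs.1.le (by ring)
  have hobj := (hz ((1 - s) • z + s • u)).trans (add_le_add_left hconv _)
  have hsplit : (1 - s) • z + s • u - x = s • (u - z) - (x - z) := by module
  simp only [proxObjective, ha] at hobj
  rw [← EReal.coe_add, ← EReal.coe_add, EReal.coe_le_coe_iff, hsplit,
    norm_sub_sq_real (s • (u - z)), norm_smul, Real.norm_eq_abs, mul_pow |s|, sq_abs,
    real_inner_smul_left, norm_sub_rev z x, real_inner_comm] at hobj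
  field_simp at hobj
  refine le_of_mul_le_mul_left ?_ hs.1
  linear_combination hobj / 2

theorem mem_minimizers_proxObjective_of_add_inner_le (hbot : ∀ u, f u ≠ ⊥) (hlam : 0 < lam)
    {x z : Euc d} {a : ℝ} (ha : f z = a)
    (hsubgrad : ∀ u (b : ℝ), f u = b → lam * a + inner ℝ (x - z) (u - z) ≤ lam * b) :
    z ∈ minimizers (proxObjective f lam x) := by
  intro u
  by_cases hu : f u = ⊤
  · rw [proxObjective, proxObjective, hu, EReal.top_add_coe]
    exact le_top
  have hb := EReal.coe_toReal hu (hbot u)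
  have hineq := hsubgrad u _ hb.symm
  have hsq := sq_nonneg ‖u - z‖
  have hsplit : u - x = (u - z) - (x - z) := by abel
  rw [proxObjective, proxObjective, ha, ← hb, ← EReal.coe_add, ← EReal.coe_add,
    EReal.coe_le_coe_iff, hsplit, norm_sub_sq_real (u - z), norm_sub_rev z x, real_inner_comm]
  field_simp
  linarith

theorem ProperClosedConvex.eq_of_mem_minimizers_proxObjective (hf : ProperClosedConvex f)
    (hlam : 0 < lam) {x z z' : Euc d} (hz : z ∈ minimizers (proxObjective f lam x))
    (hz' : z' ∈ minimizers (proxObjective f lam x)) : z = z' := by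
  have ha := (hf.coe_toReal (hf.ne_top_of_mem_minimizers_proxObjective hz)).symm
  have hb := (hf.coe_toReal (hf.ne_top_of_mem_minimizers_proxObjective hz')).symm
  have hsum := add_le_add (hf.add_inner_le_of_mem_minimizers hlam hz ha hb)
    (hf.add_inner_le_of_mem_minimizers hlam hz' hb ha)
  have hnorm : inner ℝ (x - z) (z' - z) + inner ℝ (x - z') (z - z') = ‖z - z'‖ ^ 2 := by
    rw [← neg_sub z z', inner_neg_right, ← sub_eq_neg_add, ← inner_sub_left,
      sub_sub_sub_cancel_left, real_inner_self_eq_norm_sq]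
  have hzero : ‖z - z'‖ ^ 2 ≤ 0 := by linarith
  rwa [sq_nonpos_iff, norm_eq_zero, sub_eq_zero] at hzero

theorem ProperClosedConvex.existsUnique_mem_minimizers_proxObjective (hf : ProperClosedConvex f)
    (hlam : 0 < lam) (hmin : (minimizers f).Nonempty) (x : Euc d) :
    ∃! z, z ∈ minimizers (proxObjective f lam x) :=
  existsUnique_of_exists_of_unique (hf.exists_mem_minimizers_proxObjective hlam hmin x)
    fun _ _ => hf.eq_of_mem_minimizers_proxObjective hlam

theorem prox_mem_minimizers {x z : Euc d} (hz : z ∈ minimizers (proxObjective f lam x)) :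
    prox f lam x ∈ minimizers (proxObjective f lam x) :=
  Classical.epsilon_spec ⟨z, hz⟩

theorem ProperClosedConvex.prox_eq (hf : ProperClosedConvex f) (hlam : 0 < lam) {x z : Euc d}
    (hz : z ∈ minimizers (proxObjective f lam x)) : prox f lam x = z :=
  hf.eq_of_mem_minimizers_proxObjective hlam (prox_mem_minimizers hz) hz

theorem ProperClosedConvex.prox_eq_self (hf : ProperClosedConvex f) (hlam : 0 < lam)
    {x : Euc d} (hx : x ∈ minimizers f) : prox f lam x = x := by
  have ha := hf.coe_toReal (hf.ne_top_of_mem_minimizers hx)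
  refine hf.prox_eq hlam (mem_minimizers_proxObjective_of_add_inner_le hf.ne_bot hlam ha.symm
    fun u b hb => ?_)
  rw [sub_self, inner_zero_left, add_zero]
  refine mul_le_mul_of_nonneg_left (EReal.coe_le_coe_iff.1 ?_) hlam.le
  rw [ha, ← hb]
  exact hx u

theorem ProperClosedConvex.prox_mem (hf : ProperClosedConvex f) (hlam : 0 < lam)
    (hmin : (minimizers f).Nonempty) (x : Euc d) :
    prox f lam x ∈ minimizers (proxObjective f lam x) :=
  have ⟨_, hz⟩ := hf.exists_mem_minimizers_proxObjective hlam hmin x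
  prox_mem_minimizers hz

theorem ProperClosedConvex.coe_toReal_prox (hf : ProperClosedConvex f) (hlam : 0 < lam)
    (hmin : (minimizers f).Nonempty) (x : Euc d) :
    ((f (prox f lam x)).toReal : EReal) = f (prox f lam x) :=
  hf.coe_toReal (hf.ne_top_of_mem_minimizers_proxObjective (hf.prox_mem hlam hmin x))

theorem ProperClosedConvex.proxInequality (hf : ProperClosedConvex f) (hlam : 0 < lam)
    (hmin : (minimizers f).Nonempty) :
    ProxInequality (fun u => lam * (f u).toReal) (prox f lam) := fun x y =>
  hf.add_inner_le_of_mem_minimizers hlam (hf.prox_mem hlam hmin x)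
    (hf.coe_toReal_prox hlam hmin x).symm (hf.coe_toReal_prox hlam hmin y).symm

theorem ProperClosedConvex.iInf_proxObjective (hf : ProperClosedConvex f) (hlam : 0 < lam)
    (hmin : (minimizers f).Nonempty) (x : Euc d) :
    ⨅ u, proxObjective f lam x u
      = ((f (prox f lam x)).toReal + 1 / (2 * lam) * ‖prox f lam x - x‖ ^ 2 : ℝ) := by
  rw [EReal.coe_add, hf.coe_toReal_prox hlam hmin]
  exact le_antisymm (iInf_le _ _) (le_iInf (hf.prox_mem hlam hmin x))

theorem ProperClosedConvex.coe_moreauEnvelope (hf : ProperClosedConvex f) (hlam : 0 < lam)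
    (hmin : (minimizers f).Nonempty) (x : Euc d) :
    (moreauEnvelope f lam x : EReal) = ⨅ u, proxObjective f lam x u := by
  rw [moreauEnvelope, hf.iInf_proxObjective hlam hmin, EReal.toReal_coe]

theorem ProperClosedConvex.hasGradientAt_moreauEnvelope (hf : ProperClosedConvex f)
    (hlam : 0 < lam) (hmin : (minimizers f).Nonempty) (x : Euc d) :
    HasGradientAt (moreauEnvelope f lam) (lam⁻¹ • (x - prox f lam x)) x := by
  have henv : moreauEnvelope f lam = fun y => lam⁻¹ *
      (lam * (f (prox f lam y)).toReal + 1 / 2 * ‖y - prox f lam y‖ ^ 2) := by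
    ext y
    rw [moreauEnvelope, hf.iInf_proxObjective hlam hmin, EReal.toReal_coe, norm_sub_rev]
    field_simp
  rw [henv, hasGradientAt_iff_hasFDerivAt, map_smul]
  exact ((hf.proxInequality hlam hmin).hasGradientAt x).hasFDerivAt.const_mul lam⁻¹

theorem ProperClosedConvex.norm_gradient_moreauEnvelope (hf : ProperClosedConvex f)
    (hlam : 0 < lam) (hmin : (minimizers f).Nonempty) (x : Euc d) :
    ‖gradient (moreauEnvelope f lam) x‖ = ‖x - prox f lam x‖ / lam := by
  rw [(hf.hasGradientAt_moreauEnvelope hlam hmin x).gradient, norm_smul, norm_inv,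
    Real.norm_of_nonneg hlam.le, inv_mul_eq_div]

end Moreau

/-! ### The relaxed proximal point algorithm with the silver schedule -/

section SilverRPPA

variable {d : ℕ} {f : Euc d → EReal} {lam : ℝ}

theorem rppaX_eq_foldl (f : Euc d → EReal) (lam : ℝ) (l : List ℝ) (x0 : Euc d) {k : ℕ}
    (hk : k ≤ l.length) :
    rppaX f lam (fun i => l.getD i 0) x0 k = (l.take k).foldl (relaxedStep (prox f lam)) x0 := by
  induction k with
  | zero => simp [rppaX]
  | succ k ih =>
    rw [rppaX, ih (by omega), List.take_add_one, List.foldl_append,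
      List.getD_eq_getElem _ _ hk, List.getElem?_eq_getElem hk]
    rfl

theorem rppaX_silverSchedule (f : Euc d → EReal) (lam : ℝ) (m : ℕ) (x0 : Euc d) :
    rppaX f lam (silverSchedule m) x0 (2 ^ m - 1)
      = (silverList m).foldl (relaxedStep (prox f lam)) x0 := by
  rw [← length_silverList]
  exact (rppaX_eq_foldl f lam (silverList m) x0 le_rfl).trans (by rw [List.take_length])

theorem ProperClosedConvex.norm_gradient_rppaX_le (hf : ProperClosedConvex f) (hlam : 0 < lam)
    {xs : Euc d} (hxs : xs ∈ minimizers f) (m : ℕ) (x0 : Euc d) :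
    ‖gradient (moreauEnvelope f lam) (rppaX f lam (silverSchedule m) x0 (2 ^ m - 1))‖
      ≤ ‖x0 - xs‖ / (silverRatio ^ m * lam) := by
  have hP := hf.proxInequality hlam ⟨xs, hxs⟩
  have hpos := pow_pos silverRatio_pos m
  have hbound := (hP.proxRate_silverList m).mul_norm_residual_le hP hpos.le x0
    (hf.prox_eq_self hlam hxs)
  rw [hf.norm_gradient_moreauEnvelope hlam ⟨xs, hxs⟩, rppaX_silverSchedule,
    div_le_div_iff₀ hlam (by positivity)]
  nlinarith

theorem ProperClosedConvex.value_rppaZ_sub_le (hf : ProperClosedConvex f) (hlam : 0 < lam)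
    {xs : Euc d} (hxs : xs ∈ minimizers f) (m : ℕ) (x0 : Euc d) :
    f (rppaZ f lam (silverSchedule m) x0 (2 ^ m - 1))
        + ((lam / 2 * ‖gradient (moreauEnvelope f lam)
            (rppaX f lam (silverSchedule m) x0 (2 ^ m - 1))‖ ^ 2 : ℝ) : EReal)
        - f xs
      ≤ ((‖x0 - xs‖ ^ 2 / ((4 * silverRatio ^ m - 2) * lam) : ℝ) : EReal) := by
  have hP := hf.proxInequality hlam ⟨xs, hxs⟩
  have hone : 1 ≤ silverRatio ^ m := one_le_pow₀ one_le_silverRatio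
  have hbound := (hP.proxRate_silverList m).mul_value_sub_le hP hone x0
    (hf.prox_eq_self hlam hxs)
  rw [hf.norm_gradient_moreauEnvelope hlam ⟨xs, hxs⟩, rppaZ, rppaX_silverSchedule,
    ← hf.coe_toReal_prox hlam ⟨xs, hxs⟩, ← hf.coe_toReal (hf.ne_top_of_mem_minimizers hxs),
    ← EReal.coe_add, ← EReal.coe_sub, EReal.coe_le_coe_iff,
    le_div_iff₀ (mul_pos (by linarith) hlam)]
  refine le_trans (le_of_eq ?_) hbound
  field_simp

theorem properClosedConvex_coe {g : Euc d → ℝ} (hg : ConvexOn ℝ Set.univ g) :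
    ProperClosedConvex fun u => (g u : EReal) where
  ne_bot _ := EReal.coe_ne_bot _
  exists_ne_top := ⟨0, EReal.coe_ne_top _⟩
  lsc := (continuous_coe_real_ereal.comp hg.locallyLipschitz.continuous).lowerSemicontinuous
  convex_epigraph := by
    simpa only [Set.mem_univ, true_and, EReal.coe_le_coe_iff] using hg.convex_epigraph

theorem properClosedConvex_mul_norm_sub {c : ℝ} (hc : 0 ≤ c) (xs : Euc d) :
    ProperClosedConvex fun u : Euc d => ((c * ‖u - xs‖ : ℝ) : EReal) := by
  simpa only [smul_eq_mul, dist_eq_norm] using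
    properClosedConvex_coe ((convexOn_univ_dist xs).smul hc)

theorem mem_minimizers_mul_norm_sub {c : ℝ} (hc : 0 ≤ c) (xs : Euc d) :
    xs ∈ minimizers fun u : Euc d => ((c * ‖u - xs‖ : ℝ) : EReal) := by
  intro u
  rw [EReal.coe_le_coe_iff, sub_self, norm_zero, mul_zero]
  positivity

theorem prox_mul_norm_sub {η τ : ℝ} (hlam : 0 < lam) (hη : 0 ≤ η) (hτ : η ≤ τ)
    (xs w : Euc d) :
    prox (fun u : Euc d => ((η * ‖w‖ / lam * ‖u - xs‖ : ℝ) : EReal)) lam (xs + τ • w)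
      = xs + (τ - η) • w := by
  have hf := properClosedConvex_mul_norm_sub (c := η * ‖w‖ / lam) (by positivity) xs
  refine hf.prox_eq hlam (mem_minimizers_proxObjective_of_add_inner_le hf.ne_bot hlam rfl
    fun u b hb => ?_)
  obtain rfl := EReal.coe_injective hb
  have hres : xs + τ • w - (xs + (τ - η) • w) = η • w := by module
  have hsplit : u - (xs + (τ - η) • w) = (u - xs) - (τ - η) • w := by module
  have hcauchy := mul_le_mul_of_nonneg_left (real_inner_le_norm w (u - xs)) hη
  rw [hres, hsplit, add_sub_cancel_left, norm_smul, Real.norm_of_nonneg (sub_nonneg.2 hτ),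
    real_inner_smul_left, inner_sub_right, real_inner_smul_right, real_inner_self_eq_norm_sq]
  field_simp
  linarith

theorem exists_norm_gradient_rppaX_eq (hlam : 0 < lam) (m : ℕ) (x0 xs : Euc d) :
    ∃ f : Euc d → EReal, ProperClosedConvex f ∧ xs ∈ minimizers f ∧
      ‖gradient (moreauEnvelope f lam) (rppaX f lam (silverSchedule m) x0 (2 ^ m - 1))‖
        = ‖x0 - xs‖ / (silverRatio ^ m * lam) := by
  have hpos := pow_pos silverRatio_pos m
  set η := (silverRatio ^ m)⁻¹ with hη
  set w := x0 - xs with hw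
  have hη0 : 0 ≤ η := inv_nonneg.2 hpos.le
  have hc : 0 ≤ η * ‖w‖ / lam := by positivity
  have hf := properClosedConvex_mul_norm_sub hc xs
  have hxs := mem_minimizers_mul_norm_sub hc xs
  refine ⟨_, hf, hxs, ?_⟩
  have hprox := fun τ hτ => prox_mul_norm_sub (τ := τ) hlam hη0 hτ xs w
  have hη1 : η * silverRatio ^ m = 1 := inv_mul_cancel₀ hpos.ne'
  have hlast := foldl_relaxedStep_ray hη0 hprox (silverList m)
    (fun _ => nonneg_of_mem_silverList) 1 (by rw [sum_silverList]; linarith)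
  have hstart : xs + (1 : ℝ) • w = x0 := by rw [hw]; module
  have hτ : 1 - η * (silverRatio ^ m - 1) = η := by linarith
  rw [hstart, sum_silverList, hτ] at hlast
  rw [hf.norm_gradient_moreauEnvelope hlam ⟨xs, hxs⟩, rppaX_silverSchedule, hlast,
    hprox η le_rfl, add_sub_add_left_eq_sub, ← sub_smul, sub_sub_cancel, norm_smul,
    Real.norm_of_nonneg hη0, hη]
  field_simp

end SilverRPPA

theorem mainTheorem2 (d m N : ℕ) (hm : 1 ≤ m) (hN : N = 2 ^ m - 1) (lam : ℝ) (hlam : 0 < lam) :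
    -- well-posedness and the two upper bounds, with the resulting rates in `N`
    (∀ f : Euc d → EReal, ProperClosedConvex f → ∀ xstar ∈ minimizers f, ∀ x0 : Euc d,
      (∀ x : Euc d, (∃! z, z ∈ minimizers (proxObjective f lam x)) ∧
        (moreauEnvelope f lam x : EReal) = ⨅ u, proxObjective f lam x u) ∧
      Differentiable ℝ (moreauEnvelope f lam) ∧
      f (rppaZ f lam (silverSchedule m) x0 N)
          + ((lam / 2 * ‖gradient (moreauEnvelope f lam)
              (rppaX f lam (silverSchedule m) x0 N)‖ ^ 2 : ℝ) : EReal)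
          - f xstar
        ≤ ((‖x0 - xstar‖ ^ 2 / ((4 * silverRatio ^ m - 2) * lam) : ℝ) : EReal) ∧
      ‖gradient (moreauEnvelope f lam) (rppaX f lam (silverSchedule m) x0 N)‖
        ≤ ‖x0 - xstar‖ / (silverRatio ^ m * lam) ∧
      f (rppaZ f lam (silverSchedule m) x0 N)
          + ((lam / 2 * ‖gradient (moreauEnvelope f lam)
              (rppaX f lam (silverSchedule m) x0 N)‖ ^ 2 : ℝ) : EReal)
          - f xstar
        ≤ ((‖x0 - xstar‖ ^ 2 / (2 * lam * (N : ℝ) ^ Real.logb 2 silverRatio) : ℝ) : EReal) ∧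
      ‖gradient (moreauEnvelope f lam) (rppaX f lam (silverSchedule m) x0 N)‖
        ≤ ‖x0 - xstar‖ / (lam * (N : ℝ) ^ Real.logb 2 silverRatio)) ∧
    -- tightness of the gradient bound
    (∀ x0 xstar : Euc d, ∃ f : Euc d → EReal, ProperClosedConvex f ∧ xstar ∈ minimizers f ∧
      ‖gradient (moreauEnvelope f lam) (rppaX f lam (silverSchedule m) x0 N)‖
        = ‖x0 - xstar‖ / (silverRatio ^ m * lam)) ∧
    -- the exponent of the rate
    silverRatio ^ m = ((N : ℝ) + 1) ^ Real.logb 2 silverRatio ∧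
    |Real.logb 2 silverRatio - 1.2716| < 0.00005 := by
  subst hN
  have hNpos : (0 : ℝ) < (2 ^ m - 1 : ℕ) :=
    Nat.cast_pos.2 (Nat.sub_pos_of_lt (Nat.one_lt_two_pow (by omega)))
  have hrate := rpow_logb_le_silverRatio_pow m
  have hrate_pos := Real.rpow_pos_of_pos hNpos (Real.logb 2 silverRatio)
  have hone : 1 ≤ silverRatio ^ m := one_le_pow₀ one_le_silverRatio
  refine ⟨fun f hf xstar hxstar x0 => ?_, exists_norm_gradient_rppaX_eq hlam m,
    silverRatio_pow_eq m, abs_logb_silverRatio_sub_lt⟩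
  have hmin : (minimizers f).Nonempty := ⟨xstar, hxstar⟩
  have hvalue := hf.value_rppaZ_sub_le hlam hxstar m x0
  have hgradient := hf.norm_gradient_rppaX_le hlam hxstar m x0
  refine ⟨fun x => ⟨hf.existsUnique_mem_minimizers_proxObjective hlam hmin x,
      hf.coe_moreauEnvelope hlam hmin x⟩,
    fun x => (hf.hasGradientAt_moreauEnvelope hlam hmin x).differentiableAt,
    hvalue, hgradient, hvalue.trans (EReal.coe_le_coe_iff.2 ?_), hgradient.trans ?_⟩
  · exact div_le_div_of_nonneg_left (sq_nonneg _) (mul_pos (mul_pos two_pos hlam) hrate_pos)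
      (by nlinarith)
  · exact div_le_div_of_nonneg_left (norm_nonneg _) (mul_pos hlam hrate_pos) (by nlinarith)
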